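/- Let $d\ge 1$. For $p\in[1,\infty)$, $a\in[0,1)$ and a locally integrable function $f:\mathbb R^d\to\mathbb R$ put $$\|f\|^\sharp_{p,a}=\sup_{B}\Big(\frac1{|B|^{1+ap/d}}\int_B\Big|f(y)-\frac1{|B|}\int_B f\Big|^p\,dy\Big)^{1/p}\in[0,\infty],$$ the supremum being over all balls $B\subset\mathbb R^d$. For a bi-Lipschitz map $\phi:\mathbb R^d\to\mathbb R^d$ put $$K_\phi=\sup_{x\ne y}\Big(\frac{|\phi(x)-\phi(y)|}{|x-y|}+\frac{|x-y|}{|\phi(x)-\phi(y)|}\Big),$$ and let $\rho_0(r)=\log r$ and $\rho_a(r)=r^a$ for $a>0$. Then for all $p\in[1,\infty)$ and $a\in[0,1)$ there is a constant $C>0$, depending only on $d$, $p$ and $a$, such that for every bi-Lipschitz map $\phi:\mathbb R^d\to\mathbb R^d$ that preserves Lebesgue measure and every locally integrable $f:\mathbb R^d\to\mathbb R$, the function $f\circ\phi$ is locally integrable and $$\|f\circ\phi\|^\sharp_{p,a}\le C\,\rho_a(K_\phi)\,\|f\|^\sharp_{p,a}.$$ In particular, $\|f\circ\phi\|^\sharp_{p,0}\le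 C\log(K_\phi)\,\|f\|^\sharp_{p,0}$ for $f$ in $\mathrm{BMO}_p$ (with $p=1$: $\mathrm{BMO}$), and $\|f\circ\phi\|^\sharp_{p,a}\le C K_\phi^{a}\,\|f\|^\sharp_{p,a}$ for $f\in\mathrm{Lip}_p(a)$, $0<a<1$; here $\mathrm{BMO}_p$ and $\mathrm{Lip}_p(a)$ are the spaces of locally integrable $f$ with $\|f\|^\sharp_{p,0}<\infty$ and $\|f\|^\sharp_{p,a}<\infty$ respectively. -/

import Mathlib

open MeasureTheory
open scoped NNReal ENNReal

noncomputable section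

/-- A bi-Lipschitz map of `ℝ^d`: `L⁻¹ |x - y| ≤ |φ x - φ y| ≤ L |x - y|` for some `L`.
When `φ` also preserves Lebesgue measure it is automatically onto, hence a homeomorphism. -/
def IsBiLipschitz {d : ℕ} (φ : EuclideanSpace ℝ (Fin d) → EuclideanSpace ℝ (Fin d)) : Prop :=
  ∃ L : ℝ≥0, LipschitzWith L φ ∧ AntilipschitzWith L φ

/-- `K_φ = sup_{x ≠ y} ( |φ x - φ y| / |x - y| + |x - y| / |φ x - φ y| )`. -/
def biLipConst {d : ℕ} (φ : EuclideanSpace ℝ (Fin d) → EuclideanSpace ℝ (Fin d)) : ℝ :=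
  sSup {t : ℝ | ∃ x y : EuclideanSpace ℝ (Fin d), x ≠ y ∧
    t = ‖φ x - φ y‖ / ‖x - y‖ + ‖x - y‖ / ‖φ x - φ y‖}

/-- `ρ_a(r) = r ^ a` for `a > 0`, and `ρ_0(r) = log r`. -/
def rho (a r : ℝ) : ℝ := if 0 < a then r ^ a else Real.log r

/-- The quantity `‖f‖^♯_{p,a} ∈ [0, ∞]`: the supremum over all balls `B` of
`( |B|^{-(1 + a p / d)} ∫_B |f - av_B f|^p )^{1/p}`. -/
def sharpNorm {d : ℕ} (p a : ℝ) (f : EuclideanSpace ℝ (Fin d) → ℝ) : ℝ≥0∞ :=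
  ⨆ (x : EuclideanSpace ℝ (Fin d)) (r : ℝ) (_ : 0 < r),
    ((∫⁻ y in Metric.ball x r,
        ENNReal.ofReal (|f y - ⨍ z in Metric.ball x r, f z| ^ p)) /
      volume (Metric.ball x r) ^ (1 + a * p / (d : ℝ))) ^ (1 / p)

end

open Metric Set

/-! Let `B` have centre `x` and radius `r`, let `K` be the constant of `φ`, and put `s = r / K`. As
`φ` preserves measure, the deviation of `f ∘ φ` on `B` from a constant `c` is that of `f` on `φ ''
B`, a set of diameter at most `2 * K * r`. Take `c` to be the average of `f` over a ball around `φ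
x` of radius comparable to `K ^ 2 * s`. From a ball of radius `s` near `φ '' B` one reaches it in
about `log K` doublings, the `k`-th costing a multiple of `(2 ^ k * s) ^ a`
(`eLpNorm_sub_average_dilate_le`). The sum is of order `log K` if `a = 0`, and `(K ^ 2 * s) ^ a = K
^ a * r ^ a` if `a > 0` (`exists_dyadic_sum_le_rho`).

The local bounds add up by Fubini (`setLIntegral_le_of_forall_ball`). Nothing is lost in volume,
because the `s`-neighbourhood of `φ '' B` lies in the image of the doubled ball. -/

/-- The normalized Lebesgue measure on the ball `B(x, r)`. -/
noncomputable def ballMeasure {d : ℕ} (x : EuclideanSpace ℝ (Fin d)) (r : ℝ) :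
    Measure (EuclideanSpace ℝ (Fin d)) :=
  (volume (ball x r))⁻¹ • volume.restrict (ball x r)

variable {d : ℕ} {p a r s : ℝ} {f : EuclideanSpace ℝ (Fin d) → ℝ} {x y : EuclideanSpace ℝ (Fin d)}

/-! ### Mean oscillation as an `L^p` norm for normalized measure. -/

lemma isProbabilityMeasure_ballMeasure (x : EuclideanSpace ℝ (Fin d)) (hr : 0 < r) :
    IsProbabilityMeasure (ballMeasure x r) :=
  ⟨by simp [ballMeasure, ENNReal.inv_mul_cancel (measure_ball_pos volume x hr).ne'
    measure_ball_lt_top.ne]⟩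

lemma setAverage_ball_eq_integral_ballMeasure (f : EuclideanSpace ℝ (Fin d) → ℝ) :
    ⨍ z in ball x r, f z = ∫ z, f z ∂ballMeasure x r :=
  setAverage_eq' _ _ _

lemma MeasureTheory.LocallyIntegrable.integrable_ballMeasure (hf : LocallyIntegrable f volume)
    (hr : 0 < r) : Integrable f (ballMeasure x r) :=
  Integrable.smul_measure ((hf.integrableOn_isCompact (isCompact_closedBall x r)).mono_set
    ball_subset_closedBall) (ENNReal.inv_ne_top.2 (measure_ball_pos volume x hr).ne')

lemma eLpNorm_ballMeasure (hp : 1 ≤ p) (f : EuclideanSpace ℝ (Fin d) → ℝ) :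
    eLpNorm f (ENNReal.ofReal p) (ballMeasure x r) =
      ((volume (ball x r))⁻¹ * ∫⁻ y in ball x r, ‖f y‖ₑ ^ p) ^ (1 / p) := by
  have hp0 : 0 < p := by linarith
  rw [eLpNorm_eq_lintegral_rpow_enorm_toReal (by simpa using hp0) ENNReal.ofReal_ne_top,
    ENNReal.toReal_ofReal hp0.le, ballMeasure, lintegral_smul_measure, smul_eq_mul]

lemma sharpNorm_term_eq (hp : 1 ≤ p) (hr : 0 < r) (f : EuclideanSpace ℝ (Fin d) → ℝ) (c : ℝ) :
    ((∫⁻ y in ball x r, ENNReal.ofReal (|f y - c| ^ p)) /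
      volume (ball x r) ^ (1 + a * p / (d : ℝ))) ^ (1 / p) =
    eLpNorm (fun y => f y - c) (ENNReal.ofReal p) (ballMeasure x r) /
      volume (ball x r) ^ (a / d) := by
  have hp0 : 0 < p := by linarith
  have hV0 := (measure_ball_pos volume x hr).ne'
  have hVt : volume (ball x r) ≠ ∞ := measure_ball_lt_top.ne
  have h1 : ∀ y, ENNReal.ofReal (|f y - c| ^ p) = ‖f y - c‖ₑ ^ p := fun y => by
    rw [← ENNReal.ofReal_rpow_of_nonneg (abs_nonneg _) hp0.le, ← Real.enorm_eq_ofReal_abs]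
  have h2 : (volume (ball x r) ^ (a * p / d)) ^ (1 / p) = volume (ball x r) ^ (a / d) := by
    rw [← ENNReal.rpow_mul]; congr 1; field_simp
  simp_rw [h1]
  rw [eLpNorm_ballMeasure hp, ENNReal.rpow_add _ _ hV0 hVt, ENNReal.rpow_one, ← h2,
    ← ENNReal.div_rpow_of_nonneg _ _ (by positivity), div_eq_mul_inv, div_eq_mul_inv,
    ENNReal.mul_inv (Or.inl hV0) (Or.inl hVt)]
  rw [← mul_assoc, mul_comm (∫⁻ y in ball x r, ‖f y - c‖ₑ ^ p)]
  simp only [div_eq_mul_inv]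

lemma eLpNorm_sub_average_le (hp : 1 ≤ p) (a : ℝ) (hr : 0 < r)
    (f : EuclideanSpace ℝ (Fin d) → ℝ) (x : EuclideanSpace ℝ (Fin d)) :
    eLpNorm (fun y => f y - ∫ z, f z ∂ballMeasure x r) (ENNReal.ofReal p) (ballMeasure x r) ≤
      sharpNorm p a f * volume (ball x r) ^ (a / d) := by
  have hV0 := (measure_ball_pos volume x hr).ne'
  have hVt : volume (ball x r) ≠ ∞ := measure_ball_lt_top.ne
  have h : _ ≤ sharpNorm p a f := le_iSup₂_of_le (f := fun x r => ⨆ _ : 0 < r, _) x r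
    (le_iSup_of_le (ι := 0 < r) hr le_rfl)
  rw [sharpNorm_term_eq hp hr, setAverage_ball_eq_integral_ballMeasure] at h
  exact (ENNReal.div_le_iff (by simp [hV0, hVt]) (by simp [hV0, hVt])).1 h

lemma sharpNorm_le_of_forall (hp : 1 ≤ p) {T : ℝ≥0∞}
    (h : ∀ (x : EuclideanSpace ℝ (Fin d)) (r : ℝ), 0 < r →
      eLpNorm (fun y => f y - ∫ z, f z ∂ballMeasure x r) (ENNReal.ofReal p) (ballMeasure x r) ≤
      T * volume (ball x r) ^ (a / d)) : sharpNorm p a f ≤ T := by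
  refine iSup_le fun x => iSup_le fun r => iSup_le fun hr => ?_
  have hV0 := (measure_ball_pos volume x hr).ne'
  have hVt : volume (ball x r) ≠ ∞ := measure_ball_lt_top.ne
  rw [sharpNorm_term_eq hp hr, setAverage_ball_eq_integral_ballMeasure]
  exact (ENNReal.div_le_iff (by simp [hV0, hVt]) (by simp [hV0, hVt])).2 (h x r hr)

lemma enorm_average_sub_le_eLpNorm {α : Type*} {mα : MeasurableSpace α} {μ : Measure α}
    [IsProbabilityMeasure μ] {f : α → ℝ} (hp : 1 ≤ p) (hf : Integrable f μ) (c : ℝ) :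
    ‖(∫ z, f z ∂μ) - c‖ₑ ≤ eLpNorm (fun y => f y - c) (ENNReal.ofReal p) μ := by
  have h : (∫ z, f z ∂μ) - c = ∫ z, (f z - c) ∂μ := by
    rw [integral_sub hf (integrable_const c)]; simp
  rw [h]
  refine (enorm_integral_le_lintegral_enorm _).trans ?_
  rw [← eLpNorm_one_eq_lintegral_enorm]
  exact eLpNorm_le_eLpNorm_of_exponent_le (by simpa using hp)
    (hf.sub (integrable_const c)).aestronglyMeasurable

/-- Up to a factor 2 the average is the best constant, so oscillation may be tested against any
convenient `c`. -/
lemma eLpNorm_sub_average_le_two_mul {α : Type*} {mα : MeasurableSpace α} {μ : Measure α}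
    [IsProbabilityMeasure μ] {f : α → ℝ} (hp : 1 ≤ p) (hf : Integrable f μ) (c : ℝ) :
    eLpNorm (fun y => f y - ∫ z, f z ∂μ) (ENNReal.ofReal p) μ ≤
      2 * eLpNorm (fun y => f y - c) (ENNReal.ofReal p) μ := by
  have h : (fun y => f y - ∫ z, f z ∂μ) = (fun y => f y - c) - fun _ => (∫ z, f z ∂μ) - c := by
    ext y; simp
  have hp0 : 0 < p := by linarith
  rw [h, two_mul]
  refine (eLpNorm_sub_le (hf.sub (integrable_const c)).aestronglyMeasurable
    aestronglyMeasurable_const (by simpa using hp)).trans ?_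
  refine add_le_add le_rfl ?_
  rw [eLpNorm_const _ (by simpa using hp0) (IsProbabilityMeasure.ne_zero μ)]
  simpa using enorm_average_sub_le_eLpNorm hp hf c

/-! ### Doubling and telescoping over dyadic balls. -/

lemma volume_ball_mul (x y : EuclideanSpace ℝ (Fin d)) (hs : 0 < s) (r : ℝ) :
    volume (ball x (s * r)) = ENNReal.ofReal (s ^ d) * volume (ball y r) := by
  rw [Measure.addHaar_ball_mul_of_pos _ _ hs, Measure.addHaar_ball_center volume y]
  simp

/-- Doubling: passing from a ball to a ball of twice the radius costs at most `2 ^ d`. -/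
lemma ballMeasure_le_of_subset (h : ball y s ⊆ ball x (2 * s)) :
    ballMeasure y s ≤ (2 ^ d : ℝ≥0∞) • ballMeasure x (2 * s) := by
  rw [ballMeasure, ballMeasure, volume_ball_mul x y two_pos, smul_smul,
    ENNReal.mul_inv (by simp) (by simp), ← mul_assoc,
    ENNReal.ofReal_pow (by simp), ENNReal.ofReal_ofNat, ENNReal.mul_inv_cancel (by simp) (by simp),
    one_mul]
  gcongr

lemma eLpNorm_ballMeasure_le_of_subset (hp : 1 ≤ p)
    (h : ball y s ⊆ ball x (2 * s)) (f : EuclideanSpace ℝ (Fin d) → ℝ) :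
    eLpNorm f (ENNReal.ofReal p) (ballMeasure y s) ≤
      2 ^ d * eLpNorm f (ENNReal.ofReal p) (ballMeasure x (2 * s)) := by
  refine (eLpNorm_mono_measure f (ballMeasure_le_of_subset h)).trans ?_
  rw [eLpNorm_smul_measure_of_ne_top ENNReal.ofReal_ne_top, smul_eq_mul]
  gcongr
  have hp0 : 0 < p := by linarith
  rw [one_div, ENNReal.toReal_inv, ENNReal.toReal_ofReal hp0.le]
  -- The true factor is `2 ^ (d / p)`; `p ≥ 1` allows one free of `p`.
  calc (2 ^ d : ℝ≥0∞) ^ p⁻¹ ≤ (2 ^ d : ℝ≥0∞) ^ (1 : ℝ) :=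
        ENNReal.rpow_le_rpow_of_exponent_le (one_le_pow₀ (by norm_num)) (inv_le_one_of_one_le₀ hp)
    _ = 2 ^ d := by simp

lemma enorm_average_sub_average_le (hp : 1 ≤ p) (a : ℝ) (hf : LocallyIntegrable f volume)
    (hs : 0 < s) (h : ball y s ⊆ ball x (2 * s)) :
    ‖(∫ z, f z ∂ballMeasure y s) - ∫ z, f z ∂ballMeasure x (2 * s)‖ₑ ≤
      2 ^ d * (sharpNorm p a f * volume (ball x (2 * s)) ^ (a / d)) := by
  have := isProbabilityMeasure_ballMeasure y hs
  refine (enorm_average_sub_le_eLpNorm hp (hf.integrable_ballMeasure hs) _).trans ?_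
  refine (eLpNorm_ballMeasure_le_of_subset hp h _).trans ?_
  gcongr
  exact eLpNorm_sub_average_le hp a (by positivity) f x

lemma volume_ball_rpow (hd : 1 ≤ d) (ha : 0 ≤ a) (x y : EuclideanSpace ℝ (Fin d)) (hs : 0 < s)
    (r : ℝ) : volume (ball x (s * r)) ^ (a / d) =
      ENNReal.ofReal (s ^ a) * volume (ball y r) ^ (a / d) := by
  have hd0 : (0 : ℝ) < d := by exact_mod_cast hd
  rw [volume_ball_mul x y hs, ENNReal.mul_rpow_of_nonneg _ _ (by positivity),
    ENNReal.ofReal_rpow_of_nonneg (by positivity) (by positivity), ← Real.rpow_natCast,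
    ← Real.rpow_mul hs.le]
  congr 4
  field_simp

/-- Telescoping over dyadic dilates: the `L^p` deviation of `f` on a small ball from the average
over a large ball containing it. -/
lemma eLpNorm_sub_average_dilate_le (hd : 1 ≤ d) (hp : 1 ≤ p) (ha : 0 ≤ a)
    (hf : LocallyIntegrable f volume) (hs : 0 < s) (n : ℕ)
    (h : dist y x ≤ 2 ^ n * s) :
    eLpNorm (fun u => f u - ∫ z, f z ∂ballMeasure x (2 ^ (n + 1) * s)) (ENNReal.ofReal p)
      (ballMeasure y s) ≤
    2 ^ d * (sharpNorm p a f * volume (ball y s) ^ (a / d)) *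
      ENNReal.ofReal (∑ k ∈ Finset.range (n + 2), ((2 : ℝ) ^ k) ^ a) := by
  set q := ENNReal.ofReal p
  set M := sharpNorm p a f * volume (ball y s) ^ (a / d)
  have hprob := isProbabilityMeasure_ballMeasure y hs
  have hp0 : 0 < p := by linarith
  have hfi : Integrable f (ballMeasure y s) := hf.integrable_ballMeasure hs
  have hstep : ∀ c c' : ℝ, eLpNorm (fun u => f u - c') q (ballMeasure y s) ≤
      eLpNorm (fun u => f u - c) q (ballMeasure y s) + ‖c - c'‖ₑ := fun c c' => by
    have h : (fun u => f u - c') = (fun u => f u - c) + fun _ => c - c' := by ext; simp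
    rw [h]
    refine (eLpNorm_add_le (hfi.sub (integrable_const c)).aestronglyMeasurable
      aestronglyMeasurable_const (by simpa [q] using hp)).trans ?_
    rw [eLpNorm_const _ (by simpa [q] using hp0) (IsProbabilityMeasure.ne_zero _)]
    simp only [measure_univ, ENNReal.one_rpow, mul_one]
    exact le_rfl
  have hsplit : ∀ m : ℕ, ENNReal.ofReal (∑ k ∈ Finset.range (m + 1), ((2 : ℝ) ^ k) ^ a) =
      ENNReal.ofReal (∑ k ∈ Finset.range m, ((2 : ℝ) ^ k) ^ a) +
        ENNReal.ofReal (((2 : ℝ) ^ m) ^ a) := fun m => by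
    rw [Finset.sum_range_succ, ENNReal.ofReal_add (Finset.sum_nonneg fun _ _ => by positivity)
      (by positivity)]
  -- The new centre `w` is free: the chain stays concentric at `y`, and only the last doubling moves
  -- to `x`.
  have hjump : ∀ (m : ℕ) (w : EuclideanSpace ℝ (Fin d)),
      ball y (2 ^ m * s) ⊆ ball w (2 ^ (m + 1) * s) →
      ‖(∫ z, f z ∂ballMeasure y (2 ^ m * s)) - ∫ z, f z ∂ballMeasure w (2 ^ (m + 1) * s)‖ₑ ≤
        2 ^ d * M * ENNReal.ofReal (((2 : ℝ) ^ (m + 1)) ^ a) := fun m w hw => by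
    have e : (2 : ℝ) ^ (m + 1) * s = 2 * (2 ^ m * s) := by ring
    have := volume_ball_rpow hd ha w y (s := 2 ^ (m + 1)) (by positivity) s
    rw [e] at hw this ⊢
    refine (enorm_average_sub_average_le hp a hf (by positivity) hw).trans (le_of_eq ?_)
    rw [this]
    simp only [M]
    ring
  have hchain : ∀ m : ℕ, eLpNorm (fun u => f u - ∫ z, f z ∂ballMeasure y (2 ^ m * s)) q
      (ballMeasure y s) ≤ 2 ^ d * M *
        ENNReal.ofReal (∑ k ∈ Finset.range (m + 1), ((2 : ℝ) ^ k) ^ a) := by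
    intro m
    induction m with
    | zero =>
      simp only [pow_zero, one_mul, zero_add, Finset.range_one, Finset.sum_singleton,
        Real.one_rpow, ENNReal.ofReal_one, mul_one]
      refine (eLpNorm_sub_average_le hp a hs f y).trans ?_
      exact le_mul_of_one_le_left zero_le (one_le_pow₀ (by norm_num))
    | succ m ih =>
      rw [hsplit (m + 1), mul_add]
      refine (hstep _ _).trans (add_le_add ih (hjump m y (ball_subset_ball ?_)))
      gcongr <;> simp
  rw [hsplit (n + 1), mul_add]
  refine (hstep _ _).trans (add_le_add (hchain n) (hjump n x (ball_subset_ball' ?_)))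
  rw [pow_succ]
  linarith

/-! ### From local to global by Fubini, in place of a covering argument. -/

/-- A local bound on the averages over balls of radius `s` centred near `E` controls the integral
over `E`. -/
lemma setLIntegral_le_of_forall_ball {g : EuclideanSpace ℝ (Fin d) → ℝ≥0∞} (hg : AEMeasurable g)
    {E : Set (EuclideanSpace ℝ (Fin d))} (hE : MeasurableSet E) (hs : 0 < s) {T : ℝ≥0∞}
    (h : ∀ z ∈ thickening s E, ∫⁻ y in ball z s, g y ≤ volume (ball z s) * T) :
    ∫⁻ y in E, g y ≤ T * volume (thickening s E) := by
  set V := volume (ball (0 : EuclideanSpace ℝ (Fin d)) s) with hV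
  have hVz : ∀ z : EuclideanSpace ℝ (Fin d), volume (ball z s) = V :=
    fun z => Measure.addHaar_ball_center volume z s
  have hV0 : V ≠ 0 := (measure_ball_pos volume _ hs).ne'
  have hVt : V ≠ ∞ := measure_ball_lt_top.ne
  have hS : MeasurableSet {w : EuclideanSpace ℝ (Fin d) × EuclideanSpace ℝ (Fin d) |
      dist w.1 w.2 < s} := (isOpen_lt continuous_dist continuous_const).measurableSet
  let F : EuclideanSpace ℝ (Fin d) → EuclideanSpace ℝ (Fin d) → ℝ≥0∞ := fun y z =>
    {w : EuclideanSpace ℝ (Fin d) × EuclideanSpace ℝ (Fin d) | dist w.1 w.2 < s}.indicator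
      (fun w => g w.1) (y, z)
  have hF : AEMeasurable (Function.uncurry F) ((volume.restrict E).prod volume) :=
    (AEMeasurable.comp_fst hg.restrict).indicator hS
  have h1 : ∀ y, ∫⁻ z, F y z = g y * V := fun y => by
    rw [← hVz y, ← setLIntegral_const, ← lintegral_indicator measurableSet_ball]
    congr with z
    simp [F, indicator, dist_comm]
  have h2 : ∀ z, ∫⁻ y in E, F y z ≤ (thickening s E).indicator (fun _ => V * T) z := fun z => by
    by_cases hz : z ∈ thickening s E
    · rw [indicator_of_mem hz, ← hVz z]
      refine le_trans ?_ (h z hz)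
      rw [← lintegral_indicator measurableSet_ball]
      refine (setLIntegral_le_lintegral _ _).trans (lintegral_mono fun y => le_of_eq ?_)
      simp [F, indicator]
    · rw [indicator_of_notMem hz, nonpos_iff_eq_zero]
      refine setLIntegral_eq_zero hE fun y hy => ?_
      refine indicator_of_notMem (fun hyz => hz ?_) _
      exact mem_thickening_iff.2 ⟨y, hy, by simpa [dist_comm] using hyz⟩
  have key : (∫⁻ y in E, g y) * V ≤ T * volume (thickening s E) * V := by
    calc (∫⁻ y in E, g y) * V = ∫⁻ y in E, ∫⁻ z, F y z := by
          simp_rw [h1]; rw [lintegral_mul_const' _ _ hVt]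
      _ = ∫⁻ z, ∫⁻ y in E, F y z := lintegral_lintegral_swap hF
      _ ≤ ∫⁻ z, (thickening s E).indicator (fun _ => V * T) z := lintegral_mono h2
      _ = T * volume (thickening s E) * V := by
          rw [lintegral_indicator_const isOpen_thickening.measurableSet]; ring
  exact (ENNReal.mul_le_mul_iff_left hV0 hVt).1 key

/-! ### Measure-preserving bi-Lipschitz maps. -/

section BiLipschitz

variable {φ : EuclideanSpace ℝ (Fin d) → EuclideanSpace ℝ (Fin d)}

lemma IsBiLipschitz.injective (hφ : IsBiLipschitz φ) : Function.Injective φ := by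
  obtain ⟨L, -, hL⟩ := hφ
  exact hL.injective

lemma IsBiLipschitz.bddAbove (hφ : IsBiLipschitz φ) :
    BddAbove {t : ℝ | ∃ x y : EuclideanSpace ℝ (Fin d), x ≠ y ∧
      t = ‖φ x - φ y‖ / ‖x - y‖ + ‖x - y‖ / ‖φ x - φ y‖} := by
  have hinj := hφ.injective
  obtain ⟨L, h1, h2⟩ := hφ
  refine ⟨L + L, ?_⟩
  rintro t ⟨x, y, hxy, rfl⟩
  have hx : 0 < ‖x - y‖ := norm_pos_iff.2 (sub_ne_zero.2 hxy)
  have hx' : 0 < ‖φ x - φ y‖ := norm_pos_iff.2 (sub_ne_zero.2 (hinj.ne hxy))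
  refine add_le_add ((div_le_iff₀ hx).2 ?_) ((div_le_iff₀ hx').2 ?_)
  · simpa [dist_eq_norm] using h1.dist_le_mul x y
  · simpa [dist_eq_norm] using h2.le_mul_dist x y

lemma IsBiLipschitz.dist_le (hφ : IsBiLipschitz φ) (x y : EuclideanSpace ℝ (Fin d)) :
    dist (φ x) (φ y) ≤ biLipConst φ * dist x y := by
  rcases eq_or_ne x y with rfl | hxy
  · simp
  have hx : 0 < ‖x - y‖ := norm_pos_iff.2 (sub_ne_zero.2 hxy)
  rw [dist_eq_norm, dist_eq_norm, ← div_le_iff₀ hx]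
  exact (le_add_of_nonneg_right (by positivity)).trans (le_csSup hφ.bddAbove ⟨x, y, hxy, rfl⟩)

lemma IsBiLipschitz.le_dist (hφ : IsBiLipschitz φ) (x y : EuclideanSpace ℝ (Fin d)) :
    dist x y ≤ biLipConst φ * dist (φ x) (φ y) := by
  rcases eq_or_ne x y with rfl | hxy
  · simp
  have hx : 0 < ‖φ x - φ y‖ := norm_pos_iff.2 (sub_ne_zero.2 (hφ.injective.ne hxy))
  rw [dist_eq_norm, dist_eq_norm, ← div_le_iff₀ hx]
  exact (le_add_of_nonneg_left (by positivity)).trans (le_csSup hφ.bddAbove ⟨x, y, hxy, rfl⟩)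

lemma IsBiLipschitz.two_le_biLipConst (hφ : IsBiLipschitz φ) (hd : 1 ≤ d) :
    2 ≤ biLipConst φ := by
  have : Nonempty (Fin d) := ⟨⟨0, hd⟩⟩
  obtain ⟨x, y, hxy⟩ := exists_pair_ne (EuclideanSpace ℝ (Fin d))
  refine le_trans ?_ (le_csSup hφ.bddAbove ⟨x, y, hxy, rfl⟩)
  have hx : 0 < ‖x - y‖ := norm_pos_iff.2 (sub_ne_zero.2 hxy)
  have hx' : 0 < ‖φ x - φ y‖ := norm_pos_iff.2 (sub_ne_zero.2 (hφ.injective.ne hxy))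
  rw [div_add_div _ _ hx.ne' hx'.ne', le_div_iff₀ (by positivity)]
  nlinarith [sq_nonneg (‖φ x - φ y‖ - ‖x - y‖)]

lemma IsBiLipschitz.continuous (hφ : IsBiLipschitz φ) : Continuous φ := by
  obtain ⟨L, h1, -⟩ := hφ
  exact h1.continuous

lemma IsBiLipschitz.isClosedEmbedding (hφ : IsBiLipschitz φ) : Topology.IsClosedEmbedding φ := by
  obtain ⟨L, h1, h2⟩ := hφ
  exact h2.isClosedEmbedding h1.uniformContinuous

/-- The range is closed, so its complement is open; having empty preimage, it is null, hence empty.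
-/
lemma IsBiLipschitz.surjective (hφ : IsBiLipschitz φ) (hm : MeasurePreserving φ volume volume) :
    Function.Surjective φ := by
  have ho : IsOpen (range φ)ᶜ := hφ.isClosedEmbedding.isClosed_range.isOpen_compl
  have h0 : volume (range φ)ᶜ = 0 := by
    rw [← hm.measure_preimage ho.measurableSet.nullMeasurableSet]
    simp
  rw [← range_eq_univ, ← compl_empty_iff]
  exact ho.measure_eq_zero_iff volume |>.1 h0

lemma IsBiLipschitz.locallyIntegrable_comp (hφ : IsBiLipschitz φ)
    (hm : MeasurePreserving φ volume volume) (hf : LocallyIntegrable f volume) :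
    LocallyIntegrable (f ∘ φ) volume := by
  rw [locallyIntegrable_iff]
  intro k hk
  have := hf.integrableOn_isCompact (hk.image hφ.continuous)
  rwa [← hm.integrableOn_comp_preimage hφ.isClosedEmbedding.measurableEmbedding,
    preimage_image_eq _ hφ.injective] at this

/-- By surjectivity a point of the neighbourhood is some `φ w`, and the lower Lipschitz bound puts
`w` within `r` of the ball. This dictates the small scale `r / K`. -/
lemma IsBiLipschitz.volume_thickening_image_ball_le (hφ : IsBiLipschitz φ) (hd : 1 ≤ d)
    (hm : MeasurePreserving φ volume volume) (x : EuclideanSpace ℝ (Fin d)) (r : ℝ) :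
    volume (thickening (r / biLipConst φ) (φ '' ball x r)) ≤ 2 ^ d * volume (ball x r) := by
  have hK := hφ.two_le_biLipConst hd
  have hsub : thickening (r / biLipConst φ) (φ '' ball x r) ⊆ φ '' ball x (2 * r) := by
    intro z hz
    obtain ⟨_, ⟨u, hu, rfl⟩, huz⟩ := mem_thickening_iff.1 hz
    obtain ⟨w, rfl⟩ := hφ.surjective hm z
    refine ⟨w, ?_, rfl⟩
    rw [lt_div_iff₀ (by linarith)] at huz
    have h1 := hφ.le_dist w u
    have h2 := dist_triangle w u x
    rw [mem_ball] at hu ⊢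
    linarith
  refine (measure_mono hsub).trans (le_of_eq ?_)
  rw [← hm.measure_preimage_emb hφ.isClosedEmbedding.measurableEmbedding,
    preimage_image_eq _ hφ.injective, volume_ball_mul x x two_pos]
  simp [ENNReal.ofReal_pow]

/-- The `L^p` deviation of `f ∘ φ` on `B(x, r)` from the average of `f` over a large ball
around `φ x`. -/
lemma IsBiLipschitz.eLpNorm_comp_sub_le (hφ : IsBiLipschitz φ) (hd : 1 ≤ d) (hp : 1 ≤ p)
    (ha : 0 ≤ a) (hm : MeasurePreserving φ volume volume) (hf : LocallyIntegrable f volume)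
    (hr : 0 < r) (x : EuclideanSpace ℝ (Fin d)) (n : ℕ) (hn : 2 * biLipConst φ ^ 2 ≤ 2 ^ n) :
    ∃ c : ℝ, eLpNorm (fun u => (f ∘ φ) u - c) (ENNReal.ofReal p) (ballMeasure x r) ≤
      2 ^ d * (2 ^ d * (sharpNorm p a f * (ENNReal.ofReal ((biLipConst φ)⁻¹ ^ a) *
        volume (ball x r) ^ (a / d))) *
          ENNReal.ofReal (∑ k ∈ Finset.range (n + 2), ((2 : ℝ) ^ k) ^ a)) := by
  set K := biLipConst φ
  have hK : 2 ≤ K := hφ.two_le_biLipConst hd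
  have hK0 : 0 < K := by linarith
  have hp0 : 0 < p := by linarith
  set s := r / K with hs_def
  have hs : 0 < s := by positivity
  have hsr : r = K * s := by rw [hs_def]; field_simp
  set Q := 2 ^ d * (sharpNorm p a f * (ENNReal.ofReal (K⁻¹ ^ a) *
    volume (ball x r) ^ (a / d))) *
      ENNReal.ofReal (∑ k ∈ Finset.range (n + 2), ((2 : ℝ) ^ k) ^ a) with hQ
  set c := ∫ z, f z ∂ballMeasure (φ x) (2 ^ (n + 1) * s)
  refine ⟨c, ?_⟩
  have hemb := hφ.isClosedEmbedding.measurableEmbedding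
  have hlocal : ∀ z ∈ thickening s (φ '' ball x r),
      ∫⁻ y in ball z s, ‖f y - c‖ₑ ^ p ≤ volume (ball z s) * Q ^ p := by
    intro z hz
    obtain ⟨_, ⟨u, hu, rfl⟩, huz⟩ := mem_thickening_iff.1 hz
    -- The distance is at most `s + K * r ≤ 2 * K * r = 2 * K ^ 2 * s`, whence the condition on `n`.
    have hdist : dist z (φ x) ≤ 2 ^ n * s := by
      have h1 := dist_triangle z (φ u) (φ x)
      have h2 := (hφ.dist_le u x).trans (mul_le_mul_of_nonneg_left (mem_ball.1 hu).le hK0.le)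
      have h3 : s ≤ K * r := by
        rw [hsr]; nlinarith [mul_le_mul hK hK (by norm_num) hK0.le]
      calc dist z (φ x) ≤ 2 * (K * r) := by linarith
        _ = 2 * K ^ 2 * s := by rw [hsr]; ring
        _ ≤ 2 ^ n * s := by gcongr
    have h := eLpNorm_sub_average_dilate_le hd hp ha hf hs n hdist
    have hvol := volume_ball_rpow hd ha z x (inv_pos.2 hK0) r
    rw [inv_mul_eq_div] at hvol
    rw [hvol, ← hQ, eLpNorm_ballMeasure hp, one_div, ENNReal.rpow_inv_le_iff hp0] at h
    have hV0 := (measure_ball_pos volume z hs).ne'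
    rwa [← ENNReal.div_le_iff' hV0 measure_ball_lt_top.ne, ENNReal.div_eq_inv_mul]
  have hmeas : AEMeasurable (fun y => ‖f y - c‖ₑ ^ p) :=
    ((hf.aestronglyMeasurable.sub aestronglyMeasurable_const).enorm).pow_const p
  have hE : MeasurableSet (φ '' ball x r) := hemb.measurableSet_image' measurableSet_ball
  have hint := (setLIntegral_le_of_forall_ball hmeas hE hs hlocal).trans
    (mul_le_mul_right (hφ.volume_thickening_image_ball_le hd hm x r) _)
  rw [← hm.setLIntegral_comp_emb hemb] at hint
  rw [eLpNorm_ballMeasure hp, one_div, ENNReal.rpow_inv_le_iff hp0,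
    ENNReal.mul_rpow_of_nonneg _ _ hp0.le]
  have hV0 := (measure_ball_pos volume x hr).ne'
  rw [← ENNReal.div_eq_inv_mul, ENNReal.div_le_iff hV0 measure_ball_lt_top.ne]
  refine hint.trans ?_
  rw [← mul_assoc, mul_comm (Q ^ p)]
  gcongr
  calc (2 ^ d : ℝ≥0∞) = (2 ^ d : ℝ≥0∞) ^ (1 : ℝ) := by simp
    _ ≤ (2 ^ d : ℝ≥0∞) ^ p := ENNReal.rpow_le_rpow_of_exponent_le (one_le_pow₀ (by norm_num)) hp

end BiLipschitz

/-! ### The dyadic sum and the conclusion. -/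

lemma exists_dyadic_sum_le_rho (ha : 0 ≤ a) : ∃ C : ℝ, 0 < C ∧ ∀ K : ℝ, 2 ≤ K →
    ∃ n : ℕ, 2 * K ^ 2 ≤ 2 ^ n ∧
      K⁻¹ ^ a * ∑ k ∈ Finset.range (n + 2), ((2 : ℝ) ^ k) ^ a ≤ C * rho a K := by
  have hnear : ∀ K : ℝ, 2 ≤ K → ∃ n : ℕ, (2 : ℝ) ^ n ≤ 2 * K ^ 2 ∧ 2 * K ^ 2 < 2 ^ (n + 1) :=
    fun K hK => exists_nat_pow_near (by nlinarith) one_lt_two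
  rcases ha.eq_or_lt with rfl | ha
  · have h2 : 0 < Real.log 2 := Real.log_pos one_lt_two
    -- There are `n + 3` terms; `n * log 2 ≤ log 2 + 2 * log K` and `log 2 ≤ log K` give `(n + 3) *
    -- log 2 ≤ 6 * log K`.
    refine ⟨6 / Real.log 2, by positivity, fun K hK => ?_⟩
    obtain ⟨n, hn, hn'⟩ := hnear K hK
    refine ⟨n + 1, hn'.le, ?_⟩
    have hlog := Real.log_le_log (by positivity) hn
    rw [Real.log_pow, Real.log_mul (by norm_num) (by positivity), Real.log_pow] at hlog
    have hK2 := Real.log_le_log two_pos hK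
    simp only [Real.rpow_zero, Finset.sum_const, Finset.card_range, rho, lt_irrefl, if_false]
    rw [div_mul_eq_mul_div, le_div_iff₀ h2]
    push_cast at hlog ⊢
    simp only [nsmul_eq_mul]
    push_cast
    nlinarith
  · have hb : 1 < (2 : ℝ) ^ a := Real.one_lt_rpow one_lt_two ha
    have hb' : 0 < (2 : ℝ) ^ a - 1 := by linarith
    refine ⟨16 ^ a / (2 ^ a - 1), by positivity, fun K hK => ?_⟩
    obtain ⟨n, hn, hn'⟩ := hnear K hK
    refine ⟨n + 1, hn'.le, ?_⟩
    have hK0 : 0 < K := by linarith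
    have hpow : ∀ k : ℕ, ((2 : ℝ) ^ k) ^ a = ((2 : ℝ) ^ a) ^ k := fun k => by
      rw [← Real.rpow_natCast, ← Real.rpow_natCast, ← Real.rpow_mul two_pos.le,
        ← Real.rpow_mul two_pos.le, mul_comm]
    -- A geometric sum of ratio `2 ^ a > 1` is governed by its end, and `2 ^ (n + 3) ≤ 16 * K ^ 2`.
    have hsum : ∑ k ∈ Finset.range (n + 1 + 2), ((2 : ℝ) ^ k) ^ a ≤
        (16 * K ^ 2) ^ a / (2 ^ a - 1) := by
      simp_rw [hpow]
      rw [geom_sum_eq hb.ne']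
      gcongr
      refine (sub_le_self _ zero_le_one).trans ?_
      rw [← hpow]
      refine Real.rpow_le_rpow (by positivity) ?_ ha.le
      calc (2 : ℝ) ^ (n + 1 + 2) = 8 * 2 ^ n := by ring
        _ ≤ 16 * K ^ 2 := by linarith
    calc _ ≤ K⁻¹ ^ a * ((16 * K ^ 2) ^ a / (2 ^ a - 1)) := by gcongr
      _ = (K⁻¹ * (16 * K ^ 2)) ^ a / (2 ^ a - 1) := by
          rw [Real.mul_rpow (x := K⁻¹) (by positivity) (by positivity), mul_div_assoc]
      _ = (16 * K) ^ a / (2 ^ a - 1) := by congr 2; field_simp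
      _ = 16 ^ a / (2 ^ a - 1) * rho a K := by
          rw [rho, if_pos ha, Real.mul_rpow (by norm_num) hK0.le]; ring

theorem theorem2 (d : ℕ) (hd : 1 ≤ d) (p a : ℝ) (hp : 1 ≤ p) (ha₀ : 0 ≤ a) (ha₁ : a < 1) :
    ∃ C : ℝ, 0 < C ∧
      ∀ φ : EuclideanSpace ℝ (Fin d) → EuclideanSpace ℝ (Fin d),
        IsBiLipschitz φ → MeasurePreserving φ volume volume →
        ∀ f : EuclideanSpace ℝ (Fin d) → ℝ, LocallyIntegrable f volume →
          LocallyIntegrable (f ∘ φ) volume ∧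
          sharpNorm p a (f ∘ φ) ≤
            ENNReal.ofReal (C * rho a (biLipConst φ)) * sharpNorm p a f := by
  obtain ⟨C, hC, hsum⟩ := exists_dyadic_sum_le_rho ha₀
  refine ⟨2 * 2 ^ d * 2 ^ d * C, by positivity, fun φ hφ hm f hf => ?_⟩
  have hfφ := hφ.locallyIntegrable_comp hm hf
  refine ⟨hfφ, sharpNorm_le_of_forall hp fun x r hr => ?_⟩
  have hK := hφ.two_le_biLipConst hd
  obtain ⟨n, hn, hS⟩ := hsum _ hK
  obtain ⟨c, hc⟩ := hφ.eLpNorm_comp_sub_le hd hp ha₀ hm hf hr x n hn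
  have := isProbabilityMeasure_ballMeasure x hr
  refine (eLpNorm_sub_average_le_two_mul hp (hfφ.integrable_ballMeasure hr) c).trans ?_
  refine (mul_le_mul_right hc 2).trans ?_
  set K := biLipConst φ
  calc _ = 2 * 2 ^ d * 2 ^ d * ENNReal.ofReal (K⁻¹ ^ a *
          ∑ k ∈ Finset.range (n + 2), ((2 : ℝ) ^ k) ^ a) * sharpNorm p a f *
          volume (ball x r) ^ (a / d) := by
        rw [ENNReal.ofReal_mul (by positivity)]; ring
    _ ≤ 2 * 2 ^ d * 2 ^ d * ENNReal.ofReal (C * rho a K) * sharpNorm p a f *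
          volume (ball x r) ^ (a / d) := by gcongr
    _ = _ := by
        rw [mul_assoc _ C, ENNReal.ofReal_mul (p := 2 * 2 ^ d * 2 ^ d) (by positivity)]
        simp [ENNReal.ofReal_mul, ENNReal.ofReal_pow]
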